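/- Let $k\ge 1$ be an integer. Define $A_n(k)$ by $-\dfrac{\log(1-x)}{1-x^k}=\sum_{n\ge1}A_n(k)x^n$, and let $\zeta_{A(k)}(s)=\sum_{n\ge1}A_n(k)n^{-s}$ for $\operatorname{Re}s>1$. This series converges for $\operatorname{Re}s>1$ and $\zeta_{A(k)}$ continues holomorphically to $\{\operatorname{Re}s>0,\ s\ne1\}$. For $0<|s-1|<1$ the continuation has the Laurent expansion $$\zeta_{A(k)}(s)=\frac{1}{k(s-1)^2}+\frac{\gamma}{k(s-1)}+\sum_{m=0}^{\infty}(-1)^m\frac{\gamma_{A(k)}(m)}{m!}(s-1)^m,$$ where $\gamma$ is the Euler–Mascheroni constant; this defines the constants $\gamma_{A(k)}(m)$. Let $\gamma(m)$ be the Stieltjes constants, given by $\zeta(s)=\frac1{s-1}+\sum_{m\ge0}(-1)^m\frac{\gamma(m)}{m!}(s-1)^m$, let $\psi=\Gamma'/\Gamma$, and put $$g_m=\left.\frac{d^m}{ds^m}\frac1{\Gamma(s)}\right|_{s=1},\qquad i_{m,k}=\int_0^\infty\frac{e^{-kx}}{e^{-kx}-1}\log\!\left(\frac{1-e^{-x}}{x}\right)\log^m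 x\,dx .$$ The integrals $i_{m,k}$ converge absolutely, and for every integer $m\ge0$ (with the convention $\log^0 k=1$, also for $k=1$) $$\begin{aligned}\gamma_{A(k)}(m)={}&(-1)^m\zeta^{(m)}(2)-\frac1k\sum_{v=0}^m\binom mv\frac{\psi^{(v+1)}(1)}{v+1}(-1)^v\log^{m-v}k+(-1)^m\sum_{v=0}^m\binom mv g_{m-v}\,i_{v,k}\\&+\left(\psi(1)-\frac{m+1}{m+2}\log k\right)\frac{\log^{m+1}k}{k(m+1)}+\frac1k\sum_{v=0}^m\binom mv\bigl(\gamma(v)\log k+\gamma(v+1)\bigr)\log^{m-v}k\\&-\frac1k\sum_{j=0}^m\binom mj(-1)^j\log^{m-j}k\sum_{v=0}^j\binom jv(-1)^v\psi^{(j-v)}(1)\gamma(v).\end{aligned}$$ -/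

import Mathlib

noncomputable section

/-- The numbers `A_n(k)`, given by the generating function
`-log (1 - X) / (1 - X ^ k) = ∑ A_n(k) X ^ n`; here `PowerSeries.log` is `log (1 + X)`, and
`rescale (-1)` replaces `X` by `-X`. -/
def harmonicA (k n : ℕ) : ℝ :=
  PowerSeries.coeff n
    (-(PowerSeries.rescale (-1 : ℝ) (PowerSeries.log ℝ)) *
      (1 - (PowerSeries.X : PowerSeries ℝ) ^ k)⁻¹)

/-- `Z` is the Dirichlet series `∑_{n ≥ 1} A_n(k) / n ^ s` for `Re s > 1`, continued
holomorphically to `Re s > 0`, `s ≠ 1`. -/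
def IsZetaAContinuation (k : ℕ) (Z : ℂ → ℂ) : Prop :=
  (∀ s : ℂ, 1 < s.re → LSeriesHasSum (fun n => (harmonicA k n : ℂ)) s (Z s)) ∧
    DifferentiableOn ℂ Z {s : ℂ | 0 < s.re ∧ s ≠ 1}

/-- The function `ζ_{A(k)}` on `Re s > 0`, `s ≠ 1` (the continuation is unique there). -/
def zetaA (k : ℕ) : ℂ → ℂ :=
  Classical.epsilon (IsZetaAContinuation k)

/-- The Laurent expansion
`F s = a / (s - 1) ^ 2 + b / (s - 1) + ∑_{m ≥ 0} (-1) ^ m (c m / m!) (s - 1) ^ m`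
for `0 < |s - 1| < 1`. -/
def HasStieltjesExpansion (F : ℂ → ℂ) (a b : ℂ) (c : ℕ → ℂ) : Prop :=
  ∀ s : ℂ, 0 < ‖s - 1‖ → ‖s - 1‖ < 1 →
    HasSum (fun m : ℕ => (-1 : ℂ) ^ m * (c m / (m.factorial : ℂ)) * (s - 1) ^ m)
      (F s - a / (s - 1) ^ 2 - b / (s - 1))

/-- The coefficients `c` in such an expansion of `F`. -/
def stieltjesSeq (F : ℂ → ℂ) (a b : ℂ) : ℕ → ℂ :=
  Classical.epsilon (HasStieltjesExpansion F a b)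

/-- The Stieltjes constants `γ(m)`:
`ζ(s) = 1 / (s - 1) + ∑_{m ≥ 0} (-1) ^ m (γ(m) / m!) (s - 1) ^ m`. -/
def stieltjesConst : ℕ → ℂ :=
  stieltjesSeq riemannZeta 0 1

/-- The constants `γ_{A(k)}(m)`: `ζ_{A(k)}(s)` equals
`(1 / k) / (s - 1) ^ 2 + (γ / k) / (s - 1) + ∑_{m ≥ 0} (-1) ^ m (γ_{A(k)}(m) / m!) (s - 1) ^ m`,
where `γ` is the Euler-Mascheroni constant. -/
def gammaA (k : ℕ) : ℕ → ℂ :=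
  stieltjesSeq (zetaA k) (1 / (k : ℂ)) ((Real.eulerMascheroniConstant : ℂ) / (k : ℂ))

/-- `g_m`, the `m`-th derivative of `1 / Γ` at `1`. -/
def gCoeff (m : ℕ) : ℂ :=
  iteratedDeriv m (fun s : ℂ => 1 / Complex.Gamma s) 1

/-- `ψ^{(m)}(1)`, where `ψ = Γ' / Γ`. -/
def psiOne (m : ℕ) : ℂ :=
  iteratedDeriv m Complex.digamma 1

/-- The integrand of `i_{v,k}`. -/
def iIntegrand (v k : ℕ) (x : ℝ) : ℝ :=
  Real.exp (-(k : ℝ) * x) / (Real.exp (-(k : ℝ) * x) - 1) *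
    Real.log ((1 - Real.exp (-x)) / x) * Real.log x ^ v

/-- `i_{v,k}`. -/
def iIntegral (v k : ℕ) : ℝ :=
  ∫ x in Set.Ioi (0 : ℝ), iIntegrand v k x

/-- The Laurent coefficients are determined by the function. -/
theorem HasStieltjesExpansion.unique {F : ℂ → ℂ} {a b : ℂ} {c d : ℕ → ℂ}
    (hc : HasStieltjesExpansion F a b c) (hd : HasStieltjesExpansion F a b d) : c = d := by
  set e : ℕ → ℂ := fun m => (-1 : ℂ) ^ m * ((c m - d m) / (m.factorial : ℂ)) with he
  set g : ℂ → ℂ := fun s => if s = 0 then e 0 else 0 with hg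
  have key : ∀ s : ℂ, ‖s‖ < 1 → HasSum (fun m : ℕ => s ^ m • e m) (g s) := by
    intro s hs
    by_cases h0 : s = 0
    · subst h0
      have := hasSum_single (f := fun m : ℕ => (0 : ℂ) ^ m • e m) 0 (by
        intro m hm
        simp [hm])
      simpa [hg] using this
    · have h1 := hc (1 + s) (by simpa using h0) (by simpa using hs)
      have h2 := hd (1 + s) (by simpa using h0) (by simpa using hs)
      have h3 := h1.sub h2
      rw [sub_self] at h3
      simp only [hg, if_neg h0]
      convert! h3 using 2 with m
      simp only [he, smul_eq_mul, add_sub_cancel_left]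
      ring
  have hps : HasFPowerSeriesAt g (FormalMultilinearSeries.ofScalars ℂ e) 0 := by
    rw [hasFPowerSeriesAt_iff]
    filter_upwards [Metric.ball_mem_nhds (0 : ℂ) one_pos] with s hs
    have := key s (by simpa using hs)
    simpa using this
  have hcont : ContinuousAt g 0 := hps.continuousAt
  have hlim : Filter.Tendsto g (nhdsWithin 0 {0}ᶜ) (nhds 0) := by
    refine Filter.Tendsto.congr' ?_ tendsto_const_nhds
    filter_upwards [self_mem_nhdsWithin] with s hs
    simp only [hg]
    rw [if_neg (by simpa using hs)]
  have he0 : g 0 = 0 := tendsto_nhds_unique (hcont.tendsto.mono_left nhdsWithin_le_nhds) hlim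
  have hg0 : g = 0 := by
    funext s
    by_cases h0 : s = 0
    · rw [h0]; exact he0
    · simp [hg, h0]
  rw [hg0] at hps
  have hz := hps.eq_zero
  funext m
  have hm : e m = 0 := by
    have hcoeff := congrArg (fun p => FormalMultilinearSeries.coeff p m) hz
    have h0 : (0 : FormalMultilinearSeries ℂ ℂ ℂ).coeff m = 0 := rfl
    simpa [h0] using hcoeff
  simp only [he, mul_eq_zero, div_eq_zero_iff] at hm
  rcases hm with hm | hm | hm
  · exact absurd hm (pow_ne_zero _ (by norm_num))
  · exact sub_eq_zero.mp hm
  · exact absurd hm (Nat.cast_ne_zero.mpr (Nat.factorial_ne_zero m))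

/-- The Stieltjes constants satisfy their defining expansion. -/
theorem hasStieltjesExpansion_riemannZeta :
    HasStieltjesExpansion riemannZeta 0 1 stieltjesConst := by
  refine Classical.epsilon_spec (p := HasStieltjesExpansion riemannZeta 0 1) ?_
  set f : ℂ → ℂ := fun s => riemannZeta s - 1 / (s - 1) with hf
  set h : ℂ → ℂ := Function.update f 1 (Real.eulerMascheroniConstant : ℂ) with hh
  have hd : DifferentiableOn ℂ h Set.univ := by
    rw [← Complex.differentiableOn_compl_singleton_and_continuousAt_iff (c := 1)
      Filter.univ_mem]
    constructor
    · intro s hs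
      have hs1 : s ≠ 1 := hs.2
      have : DifferentiableAt ℂ f s :=
        (differentiableAt_riemannZeta hs1).sub ((differentiableAt_const _).div
          (differentiableAt_id.sub_const 1) (sub_ne_zero.mpr hs1))
      refine (this.congr_of_eventuallyEq ?_).differentiableWithinAt
      filter_upwards [isOpen_ne.mem_nhds hs1] with t ht
      exact Function.update_of_ne ht _ _
    · rw [hh, continuousAt_update_same]
      exact tendsto_riemannZeta_sub_one_div
  refine ⟨fun m => (-1) ^ m * iteratedDeriv m h 1, fun s hs0 hs1 => ?_⟩
  have ht := Complex.hasSum_taylorSeries_on_ball (c := 1) (r := 1)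
    (hd.mono (Set.subset_univ _)) (z := s) (by simpa [dist_eq_norm] using hs1)
  have hs : s ≠ 1 := by
    rintro rfl
    simp at hs0
  have hv : h s = riemannZeta s - 0 / (s - 1) ^ 2 - 1 / (s - 1) := by
    rw [hh, Function.update_of_ne hs, hf]
    simp
  rw [hv] at ht
  convert! ht using 2 with m
  have h1 : ((-1 : ℂ) ^ m) * (-1) ^ m = 1 := by
    rw [← mul_pow]; norm_num
  simp only [smul_eq_mul, div_eq_mul_inv]
  linear_combination (iteratedDeriv m h 1 * ((m.factorial : ℂ))⁻¹ * (s - 1) ^ m) * h1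

end

/-! For `Re s > 1`, putting `x = e^(-t)` in the generating function makes `Γ(s) ζ_{A(k)}(s)` the
Mellin transform of `-log(1 - e^(-t)) / (1 - e^(-kt))`. Write `1 / (1 - e^(-kt)) = 1 + 1 / (e^(kt) -
1)` and `log(1 - e^(-t)) = log t + log((1 - e^(-t)) / t)`. Three pieces arise
(`generatingFunction_eq`): `-log(1 - e^(-t))` gives `Γ(s) ζ(s+1)`; `iIntegrand 0 k` is bounded at
`0`, so its transform is holomorphic on `Re s > 0`; and `-log t / (e^(kt) - 1)` gives minus the
derivative of `k^(-s) Γ(s) ζ(s)`. Division by `Γ(s)` yields `zetaAFormula`, holomorphic on the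
required domain, and the identity theorem identifies it with `zetaA`.

The constants are then read off at `s = 1`. In the variable `w = 1 - s` the expansion becomes an
exponential series `∑ c m / m! * w ^ m`, so products of functions become binomial convolutions
(`HasExpSum.mul`) and removal of a pole becomes an index shift (`HasExpSum.shift`). Once the polar
part is split off (`zetaAFormula_sub_polar`), every factor has a known series, and uniqueness of
Laurent coefficients finishes the proof. -/

noncomputable section

open Filter Topology Finset

/-! ### Calculus of exponential series in `w = 1 - s`. -/

/-- The sum `f` of the exponential series `∑ c m / m! * w ^ m` at the point `w`. -/
def HasExpSum (w : ℂ) (c : ℕ → ℂ) (f : ℂ) : Prop :=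
  HasSum (fun m : ℕ => c m / (m.factorial : ℂ) * w ^ m) f

namespace HasExpSum

variable {w f g : ℂ} {c d : ℕ → ℂ}

theorem add (hf : HasExpSum w c f) (hg : HasExpSum w d g) :
    HasExpSum w (fun m => c m + d m) (f + g) := by
  unfold HasExpSum at *
  convert! HasSum.add hf hg using 2 with m
  ring

theorem sub (hf : HasExpSum w c f) (hg : HasExpSum w d g) :
    HasExpSum w (fun m => c m - d m) (f - g) := by
  unfold HasExpSum at *
  convert! HasSum.sub hf hg using 2 with m
  ring

theorem const_mul (a : ℂ) (hf : HasExpSum w c f) :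
    HasExpSum w (fun m => a * c m) (a * f) := by
  unfold HasExpSum at *
  convert! HasSum.mul_left a hf using 2 with m
  ring

/-- Products of exponential series have binomial convolutions as coefficients. -/
theorem mul (hf : HasExpSum w c f) (hg : HasExpSum w d g) :
    HasExpSum w (fun m => ∑ v ∈ range (m + 1), (m.choose v : ℂ) * c v * d (m - v)) (f * g) := by
  unfold HasExpSum at *
  have hF := hf.summable.norm
  have hG := hg.summable.norm
  have h := tsum_mul_tsum_eq_tsum_sum_range_of_summable_norm hF hG
  have hs := (summable_norm_sum_mul_range_of_summable_norm hF hG).of_norm.hasSum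
  rw [← h, hf.tsum_eq, hg.tsum_eq] at hs
  convert! hs using 2 with m
  rw [sum_div, sum_mul]
  refine sum_congr rfl fun v hv => ?_
  have hvm : v ≤ m := Nat.lt_succ_iff.mp (mem_range.mp hv)
  have h1 : (m.choose v : ℂ) * (v.factorial : ℂ) * ((m - v).factorial : ℂ) = m.factorial := by
    exact_mod_cast Nat.choose_mul_factorial_mul_factorial hvm
  have h2 : (m.factorial : ℂ) ≠ 0 := Nat.cast_ne_zero.mpr m.factorial_ne_zero
  have h3 : (v.factorial : ℂ) ≠ 0 := Nat.cast_ne_zero.mpr v.factorial_ne_zero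
  have h4 : ((m - v).factorial : ℂ) ≠ 0 := Nat.cast_ne_zero.mpr (m - v).factorial_ne_zero
  have h5 : w ^ v * w ^ (m - v) = w ^ m := by rw [← pow_add, Nat.add_sub_cancel' hvm]
  have h6 : (m.choose v : ℂ) / m.factorial = 1 / (v.factorial * (m - v).factorial) := by
    rw [div_eq_div_iff h2 (mul_ne_zero h3 h4)]
    linear_combination h1
  calc (m.choose v : ℂ) * c v * d (m - v) / m.factorial * w ^ m
      = (m.choose v : ℂ) / m.factorial * (c v * d (m - v) * w ^ m) := by ring
    _ = _ := by
      rw [h6, ← h5]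
      field_simp

/-- Removing the constant term and dividing by `w`. -/
theorem shift (hw : w ≠ 0) (hf : HasExpSum w c f) :
    HasExpSum w (fun m => c (m + 1) / ((m : ℂ) + 1)) ((f - c 0) / w) := by
  unfold HasExpSum at *
  have h := (hasSum_nat_add_iff' 1).mpr hf
  have h' := h.div_const w
  simp only [range_one, sum_singleton, Nat.factorial_zero, Nat.cast_one, div_one, pow_zero,
    mul_one] at h'
  convert! h' using 2 with m
  have h2 : (m.factorial : ℂ) ≠ 0 := Nat.cast_ne_zero.mpr m.factorial_ne_zero
  have h3 : (m : ℂ) + 1 ≠ 0 := Nat.cast_add_one_ne_zero m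
  rw [Nat.factorial_succ, pow_succ]
  push_cast
  field_simp

theorem exp (L w : ℂ) : HasExpSum w (fun m => L ^ m) (Complex.exp (L * w)) := by
  unfold HasExpSum
  have h := NormedSpace.expSeries_div_hasSum_exp (𝔸 := ℂ) (L * w)
  rw [← Complex.exp_eq_exp_ℂ] at h
  convert! h using 2 with m
  rw [mul_pow]
  ring

/-- The Taylor series at `1` in the variable `1 - s`. -/
theorem taylor {F : ℂ → ℂ} (hF : DifferentiableOn ℂ F (Metric.ball 1 1)) (hw : ‖w‖ < 1) :
    HasExpSum w (fun m => (-1) ^ m * iteratedDeriv m F 1) (F (1 - w)) := by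
  have h := Complex.hasSum_taylorSeries_on_ball (c := 1) (r := 1) hF (z := 1 - w)
    (by simpa [dist_eq_norm] using hw)
  unfold HasExpSum
  convert! h using 2 with m
  have : (1 - w - 1) ^ m = (-1) ^ m * w ^ m := by
    rw [← mul_pow]
    ring
  rw [this]
  simp only [smul_eq_mul]
  ring

end HasExpSum

/-- Expansion in powers of `s - 1` from expansions in powers of `w = 1 - s`. -/
theorem hasStieltjesExpansion_of_hasExpSum {F : ℂ → ℂ} {a b : ℂ} {c : ℕ → ℂ}
    (h : ∀ w : ℂ, w ≠ 0 → ‖w‖ < 1 → HasExpSum w c (F (1 - w) - a / w ^ 2 + b / w)) :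
    HasStieltjesExpansion F a b c := by
  intro s h0 h1
  have hs : s - 1 ≠ 0 := norm_pos_iff.mp h0
  have := h (1 - s) (by rw [← neg_sub]; exact neg_ne_zero.mpr hs) (by rwa [norm_sub_rev])
  have hv : F s - a / (s - 1) ^ 2 - b / (s - 1) =
      F (1 - (1 - s)) - a / (1 - s) ^ 2 + b / (1 - s) := by
    rw [sub_sub_cancel, ← neg_sub s 1, neg_sq, div_neg, ← sub_eq_add_neg]
  unfold HasExpSum at this
  rw [hv]
  convert! this using 2 with m
  have : (1 - s) ^ m = (-1) ^ m * (s - 1) ^ m := by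
    rw [← mul_pow]
    ring
  rw [this]
  ring

/-! ### Expansions of the zeta and digamma functions at `1`. -/

/-- `ζ(s) - 1 / (s - 1)`, made entire. -/
def zetaRegular : ℂ → ℂ :=
  Function.update (fun s => riemannZeta s - 1 / (s - 1)) 1 (Real.eulerMascheroniConstant : ℂ)

theorem differentiable_zetaRegular : Differentiable ℂ zetaRegular := by
  rw [← differentiableOn_univ,
    ← Complex.differentiableOn_compl_singleton_and_continuousAt_iff (c := 1) univ_mem]
  constructor
  · intro s hs
    have hs1 : s ≠ 1 := hs.2
    refine DifferentiableAt.differentiableWithinAt (DifferentiableAt.congr_of_eventuallyEq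
      ((differentiableAt_riemannZeta hs1).sub ((differentiableAt_const (1 : ℂ)).div
        (differentiableAt_id.sub_const 1) (sub_ne_zero.mpr hs1))) ?_)
    filter_upwards [isOpen_ne.mem_nhds hs1] with t ht
    exact Function.update_of_ne ht _ _
  · rw [zetaRegular, continuousAt_update_same]
    exact tendsto_riemannZeta_sub_one_div

theorem riemannZeta_eq_zetaRegular {s : ℂ} (hs : s ≠ 1) :
    riemannZeta s = zetaRegular s + 1 / (s - 1) := by
  rw [zetaRegular, Function.update_of_ne hs]
  ring

theorem deriv_riemannZeta_eq_zetaRegular {s : ℂ} (hs : s ≠ 1) :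
    deriv riemannZeta s = deriv zetaRegular s - 1 / (s - 1) ^ 2 := by
  have h : riemannZeta =ᶠ[𝓝 s] fun t => zetaRegular t + (t - 1)⁻¹ := by
    filter_upwards [isOpen_ne.mem_nhds hs] with t ht
    rw [riemannZeta_eq_zetaRegular ht, one_div]
  rw [h.deriv_eq]
  have h1 : HasDerivAt (fun t : ℂ => (t - 1)⁻¹) (-1 / (s - 1) ^ 2) s :=
    ((hasDerivAt_id s).sub_const 1).inv (sub_ne_zero.mpr hs)
  rw [((differentiable_zetaRegular s).hasDerivAt.fun_add h1).deriv]
  ring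

theorem stieltjesConst_eq (m : ℕ) :
    stieltjesConst m = (-1) ^ m * iteratedDeriv m zetaRegular 1 := by
  have hexp : HasStieltjesExpansion riemannZeta 0 1
      fun m => (-1) ^ m * iteratedDeriv m zetaRegular 1 := by
    refine hasStieltjesExpansion_of_hasExpSum fun w hw hw1 => ?_
    have h := HasExpSum.taylor (w := w) differentiable_zetaRegular.differentiableOn hw1
    convert! h using 1
    rw [riemannZeta_eq_zetaRegular (by simpa using hw), sub_sub_cancel_left, div_neg, zero_div]
    ring
  exact congrFun (hasStieltjesExpansion_riemannZeta.unique hexp) m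

theorem hasExpSum_zetaRegular {w : ℂ} (hw : ‖w‖ < 1) :
    HasExpSum w stieltjesConst (zetaRegular (1 - w)) := by
  rw [funext stieltjesConst_eq]
  exact HasExpSum.taylor differentiable_zetaRegular.differentiableOn hw

/-- The derivative is taken in `s`, not in `w = 1 - s`; this is the source of the sign next to the
index shift. -/
theorem hasExpSum_deriv_zetaRegular {w : ℂ} (hw : ‖w‖ < 1) :
    HasExpSum w (fun m => -1 * stieltjesConst (m + 1)) (deriv zetaRegular (1 - w)) := by
  have h := HasExpSum.taylor (F := deriv zetaRegular) (w := w)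
    (differentiable_zetaRegular.differentiableOn.deriv isOpen_univ |>.mono (Set.subset_univ _)) hw
  convert! h using 2 with m
  rw [stieltjesConst_eq, iteratedDeriv_succ', pow_succ]
  ring

theorem ball_one_subset {s : ℂ} (hs : s ∈ Metric.ball (1 : ℂ) 1) : 0 < s.re := by
  have h1 : ‖s - 1‖ < 1 := by simpa [dist_eq_norm] using hs
  have h2 := (Complex.abs_re_le_norm (s - 1)).trans_lt h1
  rw [abs_lt] at h2
  simp only [Complex.sub_re, Complex.one_re] at h2
  linarith [h2.1]

theorem ne_neg_natCast_of_re_pos {s : ℂ} (hs : 0 < s.re) (m : ℕ) : s ≠ -m := by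
  rintro rfl
  simp only [Complex.neg_re, Complex.natCast_re] at hs
  linarith [(Nat.cast_nonneg m : (0 : ℝ) ≤ m)]

theorem differentiableAt_digamma {s : ℂ} (hs : 0 < s.re) :
    DifferentiableAt ℂ Complex.digamma s := by
  have hopen : IsOpen {z : ℂ | 0 < z.re} := isOpen_lt continuous_const Complex.continuous_re
  have hd : DifferentiableOn ℂ Complex.Gamma {z : ℂ | 0 < z.re} := fun z hz =>
    (Complex.differentiableAt_Gamma z (ne_neg_natCast_of_re_pos hz)).differentiableWithinAt
  exact ((hd.deriv hopen).differentiableAt (hopen.mem_nhds hs)).div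
    (hd.differentiableAt (hopen.mem_nhds hs)) (Complex.Gamma_ne_zero_of_re_pos hs)

theorem hasExpSum_digamma {w : ℂ} (hw : ‖w‖ < 1) :
    HasExpSum w (fun m => (-1) ^ m * psiOne m) (Complex.digamma (1 - w)) :=
  HasExpSum.taylor
    (fun _ hs => (differentiableAt_digamma (ball_one_subset hs)).differentiableWithinAt) hw

end

/-! ### Mellin transforms: convergence, differentiation and estimates. -/

noncomputable section

open Filter Topology Set MeasureTheory Asymptotics

/-- Local integrability on `(0, ∞)`, rapid decay at infinity, and growth at most `t ^ (-b)` at `0`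
for every `b > b₀`. -/
structure MellinAdmissible (b₀ : ℝ) (f : ℝ → ℂ) : Prop where
  locallyIntegrableOn : LocallyIntegrableOn f (Ioi 0)
  isBigO_atTop : ∀ a : ℝ, f =O[atTop] fun t => t ^ (-a)
  isBigO_zero : ∀ b : ℝ, b₀ < b → f =O[𝓝[>] 0] fun t => t ^ (-b)

namespace MellinAdmissible

variable {b₀ : ℝ} {f : ℝ → ℂ} {s : ℂ}

theorem mellinConvergent (hf : MellinAdmissible b₀ f) (hs : b₀ < s.re) : MellinConvergent f s := by
  obtain ⟨b, hb, hbs⟩ := exists_between hs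
  exact mellinConvergent_of_isBigO_rpow hf.1 (hf.2 (s.re + 1)) (by linarith) (hf.3 b hb) hbs

/-- Differentiating a Mellin transform inserts `log t`. The bound at `0` is asked only for `b > b₀`,
so the logarithm is absorbed by a slightly smaller exponent and the half-plane does not shrink. -/
theorem log_smul (hf : MellinAdmissible b₀ f) :
    MellinAdmissible b₀ fun t => Real.log t • f t := by
  refine ⟨?_, fun a => isBigO_rpow_top_log_smul (lt_add_one a) (hf.2 _), fun b hb => ?_⟩
  · exact hf.1.continuousOn_smul isOpen_Ioi.isLocallyClosed
      (Real.continuousOn_log.mono fun t ht => ne_of_gt ht)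
  · obtain ⟨c, hc, hcb⟩ := exists_between hb
    exact isBigO_rpow_zero_log_smul hcb (hf.3 c hc)

theorem hasDerivAt_mellin (hf : MellinAdmissible b₀ f) (hs : b₀ < s.re) :
    HasDerivAt (mellin f) (mellin (fun t => Real.log t • f t) s) s := by
  obtain ⟨b, hb, hbs⟩ := exists_between hs
  exact (mellin_hasDerivAt_of_isBigO_rpow hf.1 (hf.2 (s.re + 1)) (by linarith) (hf.3 b hb) hbs).2

end MellinAdmissible

/-- The function `1 / (exp (k t) - 1)`. -/
def boseKernel (k : ℕ) (t : ℝ) : ℝ := 1 / (Real.exp (k * t) - 1)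

section Estimates

variable {k : ℕ} {t : ℝ}

theorem exp_natCast_mul_sub_one_ge (t : ℝ) : (k : ℝ) * t ≤ Real.exp (k * t) - 1 := by
  linarith [Real.add_one_le_exp ((k : ℝ) * t)]

theorem exp_natCast_mul_sub_one_pos (hk : 1 ≤ k) (ht : 0 < t) : 0 < Real.exp (k * t) - 1 := by
  have : (0 : ℝ) < k := by exact_mod_cast hk
  exact (mul_pos this ht).trans_le (exp_natCast_mul_sub_one_ge t)

theorem boseKernel_pos (hk : 1 ≤ k) (ht : 0 < t) : 0 < boseKernel k t :=
  one_div_pos.mpr (exp_natCast_mul_sub_one_pos hk ht)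

theorem boseKernel_le_inv (hk : 1 ≤ k) (ht : 0 < t) : boseKernel k t ≤ t⁻¹ := by
  rw [boseKernel, ← one_div]
  refine one_div_le_one_div_of_le ht (le_trans ?_ (exp_natCast_mul_sub_one_ge t))
  have : (1 : ℝ) ≤ k := by exact_mod_cast hk
  nlinarith

theorem boseKernel_le_exp (hk : 1 ≤ k) (ht : 1 ≤ t) : boseKernel k t ≤ 2 * Real.exp (-1 * t) := by
  have h1 : (1 : ℝ) ≤ k := by exact_mod_cast hk
  have h2 : Real.exp t ≤ Real.exp (k * t) := Real.exp_le_exp.mpr (by nlinarith)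
  have h3 : t + 1 ≤ Real.exp t := Real.add_one_le_exp t
  have h4 : Real.exp t * Real.exp (-1 * t) = 1 := by
    rw [← Real.exp_add]
    simp
  rw [boseKernel, div_le_iff₀ (by linarith)]
  nlinarith [Real.exp_pos (-1 * t)]

theorem continuousOn_boseKernel (hk : 1 ≤ k) : ContinuousOn (boseKernel k) (Ioi 0) := by
  unfold boseKernel
  refine ContinuousOn.div (by fun_prop) (by fun_prop) fun t ht => ?_
  exact (exp_natCast_mul_sub_one_pos hk ht).ne'

theorem isBigO_boseKernel_atTop (hk : 1 ≤ k) (a : ℝ) :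
    boseKernel k =O[atTop] fun t => t ^ (-a) := by
  refine IsBigO.trans (IsBigO.of_bound 2 ?_) (isLittleO_exp_neg_mul_rpow_atTop one_pos (-a)).isBigO
  filter_upwards [eventually_ge_atTop 1] with t ht
  rw [Real.norm_of_nonneg (boseKernel_pos hk (by linarith)).le,
    Real.norm_of_nonneg (Real.exp_pos _).le]
  exact boseKernel_le_exp hk ht

theorem isBigO_rpow_neg_of_le {a b : ℝ} (hab : a ≤ b) :
    (fun t : ℝ => t ^ (-a)) =O[𝓝[>] 0] fun t => t ^ (-b) := by
  refine IsBigO.of_bound 1 ?_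
  filter_upwards [Ioo_mem_nhdsGT (zero_lt_one' ℝ)] with t ht
  rw [one_mul, Real.norm_of_nonneg (Real.rpow_nonneg ht.1.le _),
    Real.norm_of_nonneg (Real.rpow_nonneg ht.1.le _)]
  exact Real.rpow_le_rpow_of_exponent_ge ht.1 ht.2.le (by linarith)

/-- A function dominated by the Bose kernel is admissible for `Re s > 1`. -/
theorem mellinAdmissible_of_le_boseKernel (hk : 1 ≤ k) {f : ℝ → ℝ} (hc : ContinuousOn f (Ioi 0))
    (hf : ∀ t, 0 < t → |f t| ≤ boseKernel k t) : MellinAdmissible 1 fun t => (f t : ℂ) := by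
  refine ⟨?_, fun a => ?_, fun b hb => ?_⟩
  · exact (Complex.continuous_ofReal.comp_continuousOn hc).locallyIntegrableOn measurableSet_Ioi
  · refine IsBigO.trans (IsBigO.of_bound 1 ?_) (isBigO_boseKernel_atTop hk a)
    filter_upwards [eventually_gt_atTop 0] with t ht
    rw [Complex.norm_real, one_mul, Real.norm_of_nonneg (boseKernel_pos hk ht).le]
    exact hf t ht
  · refine IsBigO.trans (IsBigO.of_bound 1 ?_) (isBigO_rpow_neg_of_le hb.le)
    filter_upwards [self_mem_nhdsWithin] with t ht
    have ht : 0 < t := ht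
    rw [Complex.norm_real, one_mul, Real.rpow_neg_one, Real.norm_of_nonneg (inv_nonneg.mpr ht.le)]
    exact (hf t ht).trans (boseKernel_le_inv hk ht)

theorem mellinAdmissible_boseKernel (hk : 1 ≤ k) :
    MellinAdmissible 1 fun t => (boseKernel k t : ℂ) :=
  mellinAdmissible_of_le_boseKernel hk (continuousOn_boseKernel hk) fun _ ht =>
    (abs_of_pos (boseKernel_pos hk ht)).le

theorem one_sub_exp_neg_pos (ht : 0 < t) : 0 < 1 - Real.exp (-t) := by
  have : Real.exp (-t) < 1 := Real.exp_lt_one_iff.mpr (by linarith)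
  linarith

theorem mellinAdmissible_neg_log : MellinAdmissible 1
    fun t => ((-Real.log (1 - Real.exp (-t)) : ℝ) : ℂ) := by
  refine mellinAdmissible_of_le_boseKernel (k := 1) le_rfl ?_ fun t ht => ?_
  · exact (ContinuousOn.log (by fun_prop) fun _ ht => (one_sub_exp_neg_pos ht).ne').neg
  · have h1 := one_sub_exp_neg_pos ht
    have h2 : Real.log (1 - Real.exp (-t)) ≤ 0 :=
      Real.log_nonpos h1.le (by linarith [Real.exp_pos (-t)])
    rw [abs_of_nonneg (by linarith)]
    -- With `y = 1 - e^(-t)`, the bound `-log y ≤ 1 / y - 1` has right side exactly `boseKernel 1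
    -- t`.
    have h3 := Real.one_sub_inv_le_log_of_pos h1
    have h4 : Real.exp t * Real.exp (-t) = 1 := by rw [← Real.exp_add]; simp
    have h5 : Real.exp t - 1 = (1 - Real.exp (-t)) * Real.exp t := by linear_combination h4
    have h6 : boseKernel 1 t = (1 - Real.exp (-t))⁻¹ - 1 := by
      have := Real.exp_pos t
      rw [boseKernel, Nat.cast_one, one_mul, h5]
      field_simp
      linear_combination -h4
    rw [h6]
    linarith

theorem iIntegrand_zero_eq (hk : 1 ≤ k) (ht : 0 < t) :
    iIntegrand 0 k t = -(boseKernel k t * Real.log ((1 - Real.exp (-t)) / t)) := by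
  have h1 := exp_natCast_mul_sub_one_pos hk ht
  have h2 : Real.exp (-(k : ℝ) * t) * Real.exp (k * t) = 1 := by
    rw [← Real.exp_add]
    simp
  have h3 : Real.exp (-(k : ℝ) * t) / (Real.exp (-(k : ℝ) * t) - 1) = -boseKernel k t := by
    have h4 : Real.exp (-(k : ℝ) * t) - 1 ≠ 0 := by
      intro h
      have h5 : Real.exp (-(k : ℝ) * t) = 1 := by linarith
      rw [h5] at h2
      linarith
    rw [boseKernel, div_eq_iff h4]
    rw [neg_mul] at h2 ⊢
    field_simp
    linear_combination h2
  rw [iIntegrand, h3, pow_zero, mul_one, neg_mul]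

/-- Since `e^(-t) ≤ (1 - e^(-t)) / t ≤ 1`. The factor `t` cancels the pole of the Bose kernel at
`0`, which moves the convergence of the integrals from `Re s > 1` to `Re s > 0`. -/
theorem abs_log_one_sub_exp_neg_div_le (ht : 0 < t) :
    |Real.log ((1 - Real.exp (-t)) / t)| ≤ t := by
  have h1 := one_sub_exp_neg_pos ht
  have h2 : Real.exp (-t) ≤ (1 - Real.exp (-t)) / t := by
    rw [le_div_iff₀ ht]
    have h4 : Real.exp t * Real.exp (-t) = 1 := by rw [← Real.exp_add]; simp
    nlinarith [Real.add_one_le_exp t, Real.exp_pos (-t)]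
  have h3 : (1 - Real.exp (-t)) / t ≤ 1 := by
    rw [div_le_one ht]
    linarith [Real.add_one_le_exp (-t)]
  have h4 := Real.log_le_log (Real.exp_pos _) h2
  rw [Real.log_exp] at h4
  have h5 := Real.log_nonpos (div_pos h1 ht).le h3
  rw [abs_le]
  constructor <;> linarith

theorem abs_iIntegrand_zero_le (hk : 1 ≤ k) (ht : 0 < t) :
    |iIntegrand 0 k t| ≤ boseKernel k t * t := by
  rw [iIntegrand_zero_eq hk ht, abs_neg, abs_mul, abs_of_pos (boseKernel_pos hk ht)]
  exact mul_le_mul_of_nonneg_left (abs_log_one_sub_exp_neg_div_le ht) (boseKernel_pos hk ht).le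

theorem mellinAdmissible_iIntegrand (hk : 1 ≤ k) (v : ℕ) :
    MellinAdmissible 0 fun t => (iIntegrand v k t : ℂ) := by
  induction v with
  | zero =>
    refine ⟨?_, fun a => ?_, fun b hb => ?_⟩
    · refine (Complex.continuous_ofReal.comp_continuousOn ?_).locallyIntegrableOn measurableSet_Ioi
      refine ContinuousOn.congr (f := fun t => -(boseKernel k t *
        Real.log ((1 - Real.exp (-t)) / t))) ?_ fun t ht => iIntegrand_zero_eq hk ht
      refine ((continuousOn_boseKernel hk).mul (ContinuousOn.log ?_ fun t ht => ?_)).neg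
      · exact ContinuousOn.div (by fun_prop) (by fun_prop) fun t ht => ne_of_gt ht
      · exact (div_pos (one_sub_exp_neg_pos ht) ht).ne'
    · have h := (isBigO_boseKernel_atTop hk (a + 1)).mul (isBigO_refl (fun t : ℝ => t) atTop)
      refine IsBigO.trans (IsBigO.of_bound 1 ?_) (h.congr' EventuallyEq.rfl ?_)
      · filter_upwards [eventually_gt_atTop 0] with t ht
        rw [Complex.norm_real, one_mul, Real.norm_of_nonneg
          (mul_pos (boseKernel_pos hk ht) ht).le]
        exact abs_iIntegrand_zero_le hk ht
      · filter_upwards [eventually_gt_atTop 0] with t ht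
        rw [← Real.rpow_add_one ht.ne']
        congr 1
        ring
    · refine IsBigO.trans (IsBigO.of_bound 1 ?_) (isBigO_rpow_neg_of_le hb.le)
      filter_upwards [self_mem_nhdsWithin] with t ht
      have ht : 0 < t := ht
      rw [Complex.norm_real, one_mul, neg_zero, Real.rpow_zero, norm_one]
      refine (abs_iIntegrand_zero_le hk ht).trans ?_
      rw [← inv_mul_cancel₀ ht.ne']
      exact mul_le_mul_of_nonneg_right (boseKernel_le_inv hk ht) ht.le
  | succ v ih =>
    convert! ih.log_smul using 2 with t
    simp only [iIntegrand, pow_succ, Complex.real_smul]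
    push_cast
    ring

theorem log_smul_iIntegrand (v k : ℕ) :
    (fun t => Real.log t • (iIntegrand v k t : ℂ)) = fun t => (iIntegrand (v + 1) k t : ℂ) := by
  funext t
  simp only [iIntegrand, pow_succ, Complex.real_smul]
  push_cast
  ring

theorem integrableOn_iIntegrand (hk : 1 ≤ k) (v : ℕ) :
    IntegrableOn (iIntegrand v k) (Ioi (0 : ℝ)) := by
  have h := (mellinAdmissible_iIntegrand hk v).mellinConvergent (s := 1) (by simp)
  simp only [MellinConvergent, sub_self, Complex.cpow_zero, one_smul] at h
  simpa [IntegrableOn] using h.re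

theorem mellin_iIntegrand_one (v k : ℕ) :
    mellin (fun t => (iIntegrand v k t : ℂ)) 1 = (iIntegral v k : ℂ) := by
  simp only [mellin, sub_self, Complex.cpow_zero, one_smul]
  rw [iIntegral]
  exact integral_ofReal

theorem hasDerivAt_mellin_iIntegrand (hk : 1 ≤ k) (v : ℕ) {s : ℂ} (hs : 0 < s.re) :
    HasDerivAt (mellin fun t => (iIntegrand v k t : ℂ))
      (mellin (fun t => (iIntegrand (v + 1) k t : ℂ)) s) s := by
  rw [← log_smul_iIntegrand]
  exact (mellinAdmissible_iIntegrand hk v).hasDerivAt_mellin hs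

theorem iteratedDeriv_mellin_iIntegrand (hk : 1 ≤ k) (m : ℕ) {s : ℂ} (hs : 0 < s.re) :
    iteratedDeriv m (mellin fun t => (iIntegrand 0 k t : ℂ)) s =
      mellin (fun t => (iIntegrand m k t : ℂ)) s := by
  induction m generalizing s with
  | zero => rw [iteratedDeriv_zero]
  | succ m ih =>
    rw [iteratedDeriv_succ, ← (hasDerivAt_mellin_iIntegrand hk m hs).deriv]
    refine EventuallyEq.deriv_eq ?_
    filter_upwards [(isOpen_lt continuous_const Complex.continuous_re).mem_nhds hs] with z hz
    exact ih hz

theorem hasExpSum_mellin_iIntegrand (hk : 1 ≤ k) {w : ℂ} (hw : ‖w‖ < 1) :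
    HasExpSum w (fun m => (-1) ^ m * (iIntegral m k : ℂ))
      (mellin (fun t => (iIntegrand 0 k t : ℂ)) (1 - w)) := by
  have h := HasExpSum.taylor (w := w) (F := mellin fun t => (iIntegrand 0 k t : ℂ))
    (fun s hs => (hasDerivAt_mellin_iIntegrand hk 0
      (ball_one_subset hs)).differentiableAt.differentiableWithinAt) hw
  convert! h using 2 with m
  rw [iteratedDeriv_mellin_iIntegrand hk m (by simp), mellin_iIntegrand_one]

end Estimates

/-! ### Evaluation of the Mellin transforms in terms of `Γ` and `ζ`. -/

theorem summable_one_div_natCast_add_one_rpow {σ : ℝ} (hσ : 1 < σ) :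
    Summable fun n : ℕ => 1 / ((n : ℝ) + 1) ^ σ := by
  have := (summable_nat_add_iff 1).mpr (Real.summable_one_div_nat_rpow.mpr hσ)
  simpa using this

theorem exp_neg_natCast_add_one_mul (n : ℕ) (t : ℝ) :
    Real.exp (-((n : ℝ) + 1) * t) = Real.exp (-t) ^ (n + 1) := by
  rw [← Real.exp_nat_mul]
  congr 1
  push_cast
  ring

theorem mellin_boseKernel_one {s : ℂ} (hs : 1 < s.re) :
    mellin (fun t => (boseKernel 1 t : ℂ)) s = Complex.Gamma s * riemannZeta s := by
  have h := hasSum_mellin (ι := ℕ) (a := fun _ => 1) (p := fun n => (n : ℝ) + 1)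
    (F := fun t => (boseKernel 1 t : ℂ)) (s := s) (fun n => Or.inr (by positivity))
    (by linarith) (fun t ht => ?_) ?_
  · rw [← h.tsum_eq, zeta_eq_tsum_one_div_nat_add_one_cpow hs, ← tsum_mul_left]
    refine tsum_congr fun n => ?_
    push_cast
    ring
  · have ht : 0 < t := ht
    have h1 : Real.exp (-t) < 1 := Real.exp_lt_one_iff.mpr (by linarith)
    have h2 := (hasSum_geometric_of_lt_one (Real.exp_pos (-t)).le h1).mul_left (Real.exp (-t))
    have h3 : Real.exp (-t) * (1 - Real.exp (-t))⁻¹ = boseKernel 1 t := by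
      have h4 : Real.exp t * Real.exp (-t) = 1 := by rw [← Real.exp_add]; simp
      have h5 : 1 - Real.exp (-t) ≠ 0 := (one_sub_exp_neg_pos ht).ne'
      have h6 := (exp_natCast_mul_sub_one_pos le_rfl ht).ne'
      rw [Nat.cast_one, one_mul] at h6
      rw [boseKernel, Nat.cast_one, one_mul, ← div_eq_mul_inv, div_eq_div_iff h5 h6]
      linear_combination h4
    rw [h3] at h2
    have h7 := Complex.hasSum_ofReal.mpr h2
    convert! h7 using 2 with n
    rw [exp_neg_natCast_add_one_mul, one_mul, pow_succ']
  · simpa using summable_one_div_natCast_add_one_rpow hs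

/-- The substitution `t ↦ k t` reduces this to `k = 1`, where the geometric series is integrated
term by term. -/
theorem mellin_boseKernel {k : ℕ} (hk : 1 ≤ k) {s : ℂ} (hs : 1 < s.re) :
    mellin (fun t => (boseKernel k t : ℂ)) s =
      (k : ℂ) ^ (-s) * (Complex.Gamma s * riemannZeta s) := by
  have hk' : (0 : ℝ) < k := by exact_mod_cast hk
  have h := mellin_comp_mul_left (fun t => (boseKernel 1 t : ℂ)) s hk'
  rw [mellin_boseKernel_one hs, smul_eq_mul, Complex.ofReal_natCast] at h
  rw [← h]
  simp only [boseKernel, Nat.cast_one, one_mul]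

theorem mellin_neg_log {s : ℂ} (hs : 1 < s.re) :
    mellin (fun t => ((-Real.log (1 - Real.exp (-t)) : ℝ) : ℂ)) s =
      Complex.Gamma s * riemannZeta (s + 1) := by
  have h := hasSum_mellin (ι := ℕ) (a := fun n => 1 / ((n : ℂ) + 1)) (p := fun n => (n : ℝ) + 1)
    (F := fun t => ((-Real.log (1 - Real.exp (-t)) : ℝ) : ℂ)) (s := s)
    (fun n => Or.inr (by positivity)) (by linarith) (fun t ht => ?_) ?_
  · rw [← h.tsum_eq, zeta_eq_tsum_one_div_nat_add_one_cpow (by simp; linarith), ← tsum_mul_left]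
    refine tsum_congr fun n => ?_
    push_cast
    rw [Complex.cpow_add _ _ (Nat.cast_add_one_ne_zero n), Complex.cpow_one, mul_one_div,
      mul_one_div, div_div, mul_comm ((n : ℂ) + 1)]
  · have ht : 0 < t := ht
    have h1 : Real.exp (-t) < 1 := Real.exp_lt_one_iff.mpr (by linarith)
    have h2 := Real.hasSum_pow_div_log_of_abs_lt_one
      (x := Real.exp (-t)) (by rwa [abs_of_pos (Real.exp_pos _)])
    have h7 := Complex.hasSum_ofReal.mpr h2
    convert! h7 using 2 with n
    rw [exp_neg_natCast_add_one_mul]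
    push_cast
    ring
  · refine Summable.of_nonneg_of_le (fun n => by positivity) (fun n => ?_)
      (summable_one_div_natCast_add_one_rpow hs)
    refine div_le_div_of_nonneg_right ?_ (by positivity)
    rw [norm_div, norm_one, show ((n : ℂ) + 1) = ((n + 1 : ℕ) : ℂ) by push_cast; rfl,
      Complex.norm_natCast, div_le_one (by positivity)]
    push_cast
    linarith [(Nat.cast_nonneg n : (0 : ℝ) ≤ n)]

/-- The Mellin transform of `log t / (exp (k t) - 1)`. -/
theorem mellin_log_boseKernel {k : ℕ} (hk : 1 ≤ k) {s : ℂ} (hs : 1 < s.re) :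
    mellin (fun t => Real.log t • (boseKernel k t : ℂ)) s =
      Complex.Gamma s * ((k : ℂ) ^ (-s) * (Complex.digamma s * riemannZeta s +
        deriv riemannZeta s - (Real.log k : ℂ) * riemannZeta s)) := by
  have hs0 : 0 < s.re := by linarith
  have hk0 : (k : ℂ) ≠ 0 := by exact_mod_cast (by omega : k ≠ 0)
  have hs1 : s ≠ 1 := by
    rintro rfl
    simp at hs
  -- The transform with the logarithm is the derivative of the one without, so it suffices to
  -- differentiate `k^(-s) Γ(s) ζ(s)`.
  have h1 := (mellinAdmissible_boseKernel hk).hasDerivAt_mellin hs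
  have hG := (Complex.differentiableAt_Gamma s (ne_neg_natCast_of_re_pos hs0)).hasDerivAt
  have hZ := (differentiableAt_riemannZeta hs1).hasDerivAt
  have hP : HasDerivAt (fun z : ℂ => (k : ℂ) ^ (-z)) ((k : ℂ) ^ (-s) * Complex.log k * (-1)) s :=
    (hasDerivAt_neg s).const_cpow (Or.inl hk0)
  have h2 := hP.mul (hG.mul hZ)
  have h3 : mellin (fun t => (boseKernel k t : ℂ)) =ᶠ[𝓝 s]
      ((fun z : ℂ => (k : ℂ) ^ (-z)) * (Complex.Gamma * riemannZeta)) := by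
    filter_upwards [(isOpen_lt continuous_const Complex.continuous_re).mem_nhds hs] with z hz
    exact mellin_boseKernel hk hz
  rw [(h1.unique (h2.congr_of_eventuallyEq h3))]
  have hΓ := Complex.Gamma_ne_zero_of_re_pos hs0
  have h4 : deriv Complex.Gamma s = Complex.Gamma s * Complex.digamma s := by
    rw [Complex.digamma_def, logDeriv_apply]
    field_simp
  simp only [Pi.mul_apply]
  rw [h4, Complex.natCast_log]
  ring

end

/-! ### The numbers `A_n(k)` and the continuation of their Dirichlet series. -/

noncomputable section

open Filter Topology Set MeasureTheory Asymptotics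

theorem inv_one_sub_X_pow {k : ℕ} (hk : 1 ≤ k) :
    (1 - (PowerSeries.X : PowerSeries ℝ) ^ k)⁻¹ =
      PowerSeries.mk fun n => if k ∣ n then (1 : ℝ) else 0 := by
  have h0 : PowerSeries.constantCoeff (1 - (PowerSeries.X : PowerSeries ℝ) ^ k) ≠ 0 := by
    simp [show k ≠ 0 by omega]
  rw [eq_comm, PowerSeries.eq_inv_iff_mul_eq_one h0, mul_sub, mul_one]
  ext n
  rw [map_sub, PowerSeries.coeff_mul_X_pow', PowerSeries.coeff_mk, PowerSeries.coeff_one]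
  rcases Nat.lt_or_ge n k with h | h
  · rw [if_neg (not_le.mpr h), sub_zero]
    refine if_congr ⟨fun hd => Nat.eq_zero_of_dvd_of_lt hd h, ?_⟩ rfl rfl
    rintro rfl
    exact dvd_zero k
  · rw [if_pos h, PowerSeries.coeff_mk, if_neg (show n ≠ 0 by omega), sub_eq_zero]
    exact if_congr ((Nat.dvd_sub_iff_left h dvd_rfl).symm) rfl rfl

/-- The case `n = 0` relies on `1 / 0 = 0`, which lets antidiagonal sums keep their term with first
entry `0`. -/
theorem coeff_neg_rescale_log (n : ℕ) :
    PowerSeries.coeff n (-(PowerSeries.rescale (-1 : ℝ) (PowerSeries.log ℝ))) = 1 / (n : ℝ) := by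
  rw [map_neg, PowerSeries.coeff_rescale, PowerSeries.coeff_log]
  rcases eq_or_ne n 0 with rfl | hn
  · simp
  · rw [if_neg hn]
    have h : ((-1 : ℝ) ^ n) * (-1) ^ n = 1 := by
      rw [← mul_pow]
      norm_num
    simp only [eq_ratCast]
    push_cast
    rw [pow_succ]
    linear_combination (1 / (n : ℝ)) * h

/-- `A_n(k)` is the sum of `1 / a` over the decompositions `n = a + b` with `k ∣ b`. -/
theorem harmonicA_eq_sum {k : ℕ} (hk : 1 ≤ k) (n : ℕ) :
    harmonicA k n = ∑ p ∈ Finset.HasAntidiagonal.antidiagonal n, 1 / (p.1 : ℝ) * if k ∣ p.2 then 1 else 0 := by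
  rw [harmonicA, PowerSeries.coeff_mul, inv_one_sub_X_pow hk]
  simp only [coeff_neg_rescale_log, PowerSeries.coeff_mk]

theorem harmonicA_nonneg {k : ℕ} (hk : 1 ≤ k) (n : ℕ) : 0 ≤ harmonicA k n := by
  rw [harmonicA_eq_sum hk]
  refine Finset.sum_nonneg fun p _ => mul_nonneg (by positivity) ?_
  split_ifs <;> norm_num

/-- Dropping the divisibility condition leaves the harmonic number; logarithmic growth gives
absolute convergence for `Re s > 1`. -/
theorem harmonicA_le {k : ℕ} (hk : 1 ≤ k) (n : ℕ) : harmonicA k n ≤ 1 + Real.log n := by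
  refine le_trans ?_ (harmonic_le_one_add_log n)
  rw [harmonicA_eq_sum hk, Finset.Nat.sum_antidiagonal_eq_sum_range_succ_mk,
    Finset.sum_range_succ']
  simp only [Nat.cast_zero, div_zero, zero_mul, add_zero]
  rw [harmonic]
  push_cast
  refine Finset.sum_le_sum fun i _ => ?_
  split_ifs
  · simp
  · rw [mul_zero]
    positivity

theorem summable_harmonicA {k : ℕ} (hk : 1 ≤ k) {s : ℂ} (hs : 1 < s.re) :
    LSeriesSummable (fun n => (harmonicA k n : ℂ)) s := by
  obtain ⟨x, hx1, hxs⟩ := exists_between hs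
  refine LSeriesSummable_of_isBigO_rpow hxs ?_
  have h1 : (fun t : ℝ => 1 + Real.log t) =O[atTop] fun t => t ^ (x - 1) := by
    refine IsBigO.add ?_ (isLittleO_log_rpow_atTop (by linarith)).isBigO
    refine IsBigO.of_bound 1 ?_
    filter_upwards [eventually_ge_atTop 1] with t ht
    rw [norm_one, one_mul, Real.norm_of_nonneg (by positivity)]
    exact Real.one_le_rpow ht (by linarith)
  refine IsBigO.trans (IsBigO.of_bound 1 ?_) (h1.comp_tendsto tendsto_natCast_atTop_atTop)
  filter_upwards with n
  rw [Complex.norm_real, one_mul, Real.norm_of_nonneg (harmonicA_nonneg hk n), Function.comp_apply]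
  exact (harmonicA_le hk n).trans (le_abs_self _)

theorem hasSum_harmonicA_mul_pow {k : ℕ} (hk : 1 ≤ k) {x : ℝ} (h0 : 0 ≤ x) (h1 : x < 1) :
    HasSum (fun n => harmonicA k n * x ^ n) (-Real.log (1 - x) / (1 - x ^ k)) := by
  have hk0 : k ≠ 0 := by omega
  have hA : HasSum (fun n : ℕ => 1 / (n : ℝ) * x ^ n) (-Real.log (1 - x)) := by
    have h := Real.hasSum_pow_div_log_of_abs_lt_one (x := x) (by rwa [abs_of_nonneg h0])
    refine (hasSum_nat_add_iff' 1).mp ?_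
    simp only [Finset.range_one, Finset.sum_singleton, Nat.cast_zero, div_zero, zero_mul, sub_zero]
    convert! h using 2 with n
    push_cast
    ring
  have hB : HasSum (fun n : ℕ => (if k ∣ n then (1 : ℝ) else 0) * x ^ n) (1 - x ^ k)⁻¹ := by
    have h := hasSum_geometric_of_lt_one (pow_nonneg h0 k) (pow_lt_one₀ h0 h1 hk0)
    have hinj : Function.Injective fun j : ℕ => k * j := fun a b hab =>
      Nat.eq_of_mul_eq_mul_left hk hab
    rw [← hinj.hasSum_iff]
    · convert! h using 2 with n
      simp [pow_mul]
    · intro n hn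
      rw [if_neg, zero_mul]
      rintro ⟨j, rfl⟩
      exact hn ⟨j, rfl⟩
  have hs := (summable_norm_sum_mul_antidiagonal_of_summable_norm hA.summable.norm
    hB.summable.norm).of_norm.hasSum
  rw [← tsum_mul_tsum_eq_tsum_sum_antidiagonal_of_summable_norm hA.summable.norm
    hB.summable.norm, hA.tsum_eq, hB.tsum_eq] at hs
  rw [div_eq_mul_inv]
  convert! hs using 2 with n
  rw [harmonicA_eq_sum hk, Finset.sum_mul]
  refine Finset.sum_congr rfl fun p hp => ?_
  rw [← Finset.HasAntidiagonal.mem_antidiagonal.mp hp, pow_add]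
  ring

theorem generatingFunction_eq {k : ℕ} (hk : 1 ≤ k) {t : ℝ} (ht : 0 < t) :
    -Real.log (1 - Real.exp (-t)) / (1 - Real.exp (-t) ^ k) =
      -Real.log (1 - Real.exp (-t)) + iIntegrand 0 k t - Real.log t * boseKernel k t := by
  have h1 := exp_natCast_mul_sub_one_pos hk ht
  have h2 : Real.exp (-t) ^ k * Real.exp (k * t) = 1 := by
    rw [← Real.exp_nat_mul, ← Real.exp_add]
    simp
  have h3 : 1 - Real.exp (-t) ^ k ≠ 0 := by
    intro h
    have : Real.exp (-t) ^ k = 1 := by linarith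
    rw [this] at h2
    linarith
  have h4 : (1 - Real.exp (-t) ^ k)⁻¹ = 1 + boseKernel k t := by
    have h5 := h1.ne'
    rw [boseKernel]
    generalize Real.exp (-t) ^ k = a at *
    generalize Real.exp (k * t) = b at *
    field_simp
    linear_combination h2
  rw [iIntegrand_zero_eq hk ht, Real.log_div (one_sub_exp_neg_pos ht).ne' ht.ne', div_eq_mul_inv,
    h4]
  ring

theorem mellin_generatingFunction {k : ℕ} (hk : 1 ≤ k) {s : ℂ} (hs : 1 < s.re) :
    mellin (fun t => ((-Real.log (1 - Real.exp (-t)) / (1 - Real.exp (-t) ^ k) : ℝ) : ℂ)) s =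
      Complex.Gamma s * riemannZeta (s + 1) + mellin (fun t => (iIntegrand 0 k t : ℂ)) s -
      Complex.Gamma s * ((k : ℂ) ^ (-s) * (Complex.digamma s * riemannZeta s +
        deriv riemannZeta s - (Real.log k : ℂ) * riemannZeta s)) := by
  have h1 := mellinAdmissible_neg_log.mellinConvergent hs
  have h2 := (mellinAdmissible_iIntegrand hk 0).mellinConvergent (s := s) (by linarith)
  have h3 := (mellinAdmissible_boseKernel hk).log_smul.mellinConvergent hs
  rw [← mellin_log_boseKernel hk hs, ← mellin_neg_log hs]
  have h4 := integral_sub (Integrable.add h1 h2) h3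
  have h5 := integral_add h1 h2
  simp only [mellin]
  rw [← h5]
  refine Eq.trans ?_ h4
  refine setIntegral_congr_fun measurableSet_Ioi fun t ht => ?_
  simp only [Pi.add_apply]
  rw [generatingFunction_eq hk ht]
  simp only [smul_eq_mul, Complex.real_smul]
  push_cast
  ring

/-- An explicit formula for `ζ_{A(k)}` on `Re s > 0`. -/
def zetaAFormula (k : ℕ) (s : ℂ) : ℂ :=
  riemannZeta (s + 1) + 1 / Complex.Gamma s * mellin (fun t => (iIntegrand 0 k t : ℂ)) s -
    (k : ℂ) ^ (-s) * (Complex.digamma s * riemannZeta s + deriv riemannZeta s -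
      (Real.log k : ℂ) * riemannZeta s)

theorem LSeriesHasSum_zetaAFormula {k : ℕ} (hk : 1 ≤ k) {s : ℂ} (hs : 1 < s.re) :
    LSeriesHasSum (fun n => (harmonicA k n : ℂ)) s (zetaAFormula k s) := by
  have hs0 : 0 < s.re := by linarith
  have hΓ := Complex.Gamma_ne_zero_of_re_pos hs0
  have hA0 : harmonicA k 0 = 0 := by simp [harmonicA_eq_sum hk]
  have hsum := summable_harmonicA hk hs
  have h := hasSum_mellin (ι := ℕ) (a := fun n => (harmonicA k n : ℂ)) (p := fun n => (n : ℝ))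
    (F := fun t => ((-Real.log (1 - Real.exp (-t)) / (1 - Real.exp (-t) ^ k) : ℝ) : ℂ)) (s := s)
    (fun n => ?_) hs0 (fun t ht => ?_) ?_
  · rw [mellin_generatingFunction hk hs] at h
    have h' := h.mul_left (Complex.Gamma s)⁻¹
    have hv : (Complex.Gamma s)⁻¹ * (Complex.Gamma s * riemannZeta (s + 1) +
        mellin (fun t => (iIntegrand 0 k t : ℂ)) s -
        Complex.Gamma s * ((k : ℂ) ^ (-s) * (Complex.digamma s * riemannZeta s +
          deriv riemannZeta s - (Real.log k : ℂ) * riemannZeta s))) = zetaAFormula k s := by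
      rw [zetaAFormula]
      field_simp
    rw [hv] at h'
    unfold LSeriesHasSum
    convert! h' using 2 with n
    · rcases eq_or_ne n 0 with rfl | hn
      · simp [hA0]
      · rw [LSeries.term_of_ne_zero hn]
        push_cast
        field_simp
  -- The exponent `n` vanishes at `n = 0`, which is harmless because `A_0(k) = 0`.
  · rcases eq_or_ne n 0 with rfl | hn
    · simp [hA0]
    · right
      positivity
  · have ht : 0 < t := ht
    have h := hasSum_harmonicA_mul_pow hk (Real.exp_pos (-t)).le
      (Real.exp_lt_one_iff.mpr (by linarith))
    have h' := Complex.hasSum_ofReal.mpr h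
    convert! h' using 2 with n
    rw [← Real.exp_nat_mul]
    push_cast
    ring_nf
  · refine hsum.norm.congr fun n => ?_
    rcases eq_or_ne n 0 with rfl | hn
    · simp [hA0]
    · rw [LSeries.norm_term_eq, if_neg hn]

theorem differentiableOn_zetaAFormula {k : ℕ} (hk : 1 ≤ k) :
    DifferentiableOn ℂ (zetaAFormula k) {s : ℂ | 0 < s.re ∧ s ≠ 1} := by
  rintro s ⟨hs, hs1⟩
  have hk0 : (k : ℂ) ≠ 0 := by exact_mod_cast (by omega : k ≠ 0)
  have hopen : IsOpen {z : ℂ | z ≠ 1} := isOpen_ne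
  have hZ : DifferentiableOn ℂ riemannZeta {z : ℂ | z ≠ 1} := fun z hz =>
    (differentiableAt_riemannZeta hz).differentiableWithinAt
  have hZ' : DifferentiableAt ℂ (deriv riemannZeta) s :=
    (hZ.deriv hopen).differentiableAt (hopen.mem_nhds hs1)
  have hZ0 := differentiableAt_riemannZeta hs1
  have hZ1 : DifferentiableAt ℂ (fun z => riemannZeta (z + 1)) s := by
    refine DifferentiableAt.comp s (g := riemannZeta) (f := fun z => z + 1)
      (differentiableAt_riemannZeta ?_) (differentiableAt_id.add_const 1)
    rintro h
    have : s = 0 := by simpa using h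
    simp [this] at hs
  have hI := (hasDerivAt_mellin_iIntegrand hk 0 hs).differentiableAt
  have hG : DifferentiableAt ℂ (fun z => 1 / Complex.Gamma z) s :=
    (differentiableAt_const _).div
      (Complex.differentiableAt_Gamma s (ne_neg_natCast_of_re_pos hs))
      (Complex.Gamma_ne_zero_of_re_pos hs)
  have hP : DifferentiableAt ℂ (fun z : ℂ => (k : ℂ) ^ (-z)) s :=
    differentiableAt_id.neg.const_cpow (Or.inl hk0)
  have hψ := differentiableAt_digamma hs
  exact ((hZ1.add (hG.mul hI)).sub (hP.mul (((hψ.mul hZ0).add hZ').sub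
    (hZ0.const_mul _)))).differentiableWithinAt

theorem isZetaAContinuation_zetaAFormula {k : ℕ} (hk : 1 ≤ k) :
    IsZetaAContinuation k (zetaAFormula k) :=
  ⟨fun _ hs => LSeriesHasSum_zetaAFormula hk hs, differentiableOn_zetaAFormula hk⟩

theorem isZetaAContinuation_zetaA {k : ℕ} (hk : 1 ≤ k) : IsZetaAContinuation k (zetaA k) :=
  Classical.epsilon_spec (p := IsZetaAContinuation k) ⟨_, isZetaAContinuation_zetaAFormula hk⟩

/-- The punctured half-plane is a union of four convex sets: `Re s > 1`, the upper and lower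
quadrants, and the strip `0 < Re s < 1`. They are glued successively at explicit common points. -/
theorem isPreconnected_re_pos_ne_one : IsPreconnected {s : ℂ | 0 < s.re ∧ s ≠ 1} := by
  have hV : IsPreconnected {s : ℂ | 1 < s.re} := (convex_halfSpace_re_gt 1).isPreconnected
  have hU : IsPreconnected ({s : ℂ | 0 < s.re} ∩ {s : ℂ | 0 < s.im}) :=
    ((convex_halfSpace_re_gt 0).inter (convex_halfSpace_im_gt 0)).isPreconnected
  have hD : IsPreconnected ({s : ℂ | 0 < s.re} ∩ {s : ℂ | s.im < 0}) :=
    ((convex_halfSpace_re_gt 0).inter (convex_halfSpace_im_lt 0)).isPreconnected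
  have hS : IsPreconnected ({s : ℂ | 0 < s.re} ∩ {s : ℂ | s.re < 1}) :=
    ((convex_halfSpace_re_gt 0).inter (convex_halfSpace_re_lt 1)).isPreconnected
  have h1 := IsPreconnected.union (⟨2, 1⟩ : ℂ) (by simp) (by simp) hV hU
  have h2 := IsPreconnected.union (⟨2, -1⟩ : ℂ) (by simp) (by simp) h1 hD
  have h3 := IsPreconnected.union (⟨1 / 2, 1⟩ : ℂ) (by simp) (by norm_num) h2 hS
  convert! h3 using 1
  ext s
  simp only [mem_ofPred_eq, mem_union, mem_inter_iff, ne_eq, Complex.ext_iff, Complex.one_re,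
    Complex.one_im]
  constructor
  · rintro ⟨h, h'⟩
    rcases lt_trichotomy s.re 1 with hr | hr | hr
    · exact Or.inr ⟨h, hr⟩
    · rcases lt_trichotomy s.im 0 with hi | hi | hi
      · exact Or.inl (Or.inr ⟨h, hi⟩)
      · exact absurd ⟨hr, hi⟩ h'
      · exact Or.inl (Or.inl (Or.inr ⟨h, hi⟩))
    · exact Or.inl (Or.inl (Or.inl hr))
  · rintro (((h | ⟨h, h'⟩) | ⟨h, h'⟩) | ⟨h, h'⟩)
    · exact ⟨by linarith, fun hc => by linarith [hc.1]⟩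
    · exact ⟨h, fun hc => by linarith [hc.2]⟩
    · exact ⟨h, fun hc => by linarith [hc.2]⟩
    · exact ⟨h, fun hc => by linarith [hc.1]⟩

/-- Both functions sum the same Dirichlet series near `2`, so the identity theorem removes the
arbitrariness of the choice in `zetaA`. -/
theorem zetaA_eq_zetaAFormula {k : ℕ} (hk : 1 ≤ k) {s : ℂ} (hs : 0 < s.re) (hs1 : s ≠ 1) :
    zetaA k s = zetaAFormula k s := by
  have hopen : IsOpen {s : ℂ | 0 < s.re ∧ s ≠ 1} :=
    (isOpen_lt continuous_const Complex.continuous_re).inter isOpen_ne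
  have hA := isZetaAContinuation_zetaA hk
  refine (hA.2.analyticOnNhd hopen).eqOn_of_preconnected_of_eventuallyEq
    ((differentiableOn_zetaAFormula hk).analyticOnNhd hopen) isPreconnected_re_pos_ne_one
    (z₀ := 2) ⟨by simp, by norm_num⟩ ?_ ⟨hs, hs1⟩
  have h2 : (2 : ℂ) ∈ {s : ℂ | 1 < s.re} := by simp
  filter_upwards [(isOpen_lt continuous_const Complex.continuous_re).mem_nhds h2] with z hz
  exact (hA.1 z hz).unique (LSeriesHasSum_zetaAFormula hk hz)

end

/-! ### Laurent coefficients of `ζ_{A(k)}` at `1`. -/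

noncomputable section

open Finset

/-- `ζ_{A(k)}` at `1 - w`, with the polar part removed and the rest sorted into factors that have
exponential series in `w`. -/
theorem zetaAFormula_sub_polar {k : ℕ} (hk : 1 ≤ k) {w : ℂ} (hw : w ≠ 0) :
    zetaAFormula k (1 - w) - 1 / (k : ℂ) / w ^ 2 +
        (Real.eulerMascheroniConstant : ℂ) / (k : ℂ) / w =
      riemannZeta (1 - w + 1) +
      1 / Complex.Gamma (1 - w) * mellin (fun t => (iIntegrand 0 k t : ℂ)) (1 - w) +
      1 / (k : ℂ) *
        (((Complex.digamma (1 - w) - psiOne 0) / w +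
            zetaRegular (1 - w) * Real.log k - deriv zetaRegular (1 - w) -
            Complex.digamma (1 - w) * zetaRegular (1 - w)) *
            Complex.exp (Real.log k * w) +
          (psiOne 0 - Real.log k) * ((Complex.exp (Real.log k * w) - 1) / w) +
          ((Complex.exp (Real.log k * w) - 1) / w - Real.log k) / w) := by
  have hk0 : (k : ℂ) ≠ 0 := by exact_mod_cast (by omega : k ≠ 0)
  have hw1 : 1 - w ≠ 1 := by simpa using hw
  have hP : (k : ℂ) ^ (-(1 - w)) = 1 / (k : ℂ) * Complex.exp (Real.log k * w) := by
    rw [neg_sub, Complex.cpow_sub _ _ hk0, Complex.cpow_one, Complex.cpow_def_of_ne_zero hk0,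
      Complex.natCast_log]
    ring
  have hψ : psiOne 0 = -(Real.eulerMascheroniConstant : ℂ) := by
    rw [psiOne, iteratedDeriv_zero, Complex.digamma_one]
  -- The simple pole has coefficient `ψ(1) / k = -γ / k` in `1 / w`: the `log k / w` coming from
  -- `e^(w log k) / w ^ 2` cancels against `-log k * e^(w log k) / w`.
  have hγ : (Real.eulerMascheroniConstant : ℂ) = -psiOne 0 := by rw [hψ, neg_neg]
  rw [zetaAFormula, hP, riemannZeta_eq_zetaRegular hw1, deriv_riemannZeta_eq_zetaRegular hw1, hγ,
    sub_sub_cancel_left]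
  field_simp
  ring

theorem hasExpSum_riemannZeta_add_one {w : ℂ} (hw : ‖w‖ < 1) :
    HasExpSum w (fun m => (-1) ^ m * iteratedDeriv m riemannZeta 2)
      (riemannZeta (1 - w + 1)) := by
  have h := HasExpSum.taylor (w := w) (F := fun s => riemannZeta (s + 1)) (fun s hs => ?_) hw
  · convert! h using 3 with m
    rw [iteratedDeriv_comp_add_const]
    norm_num
  · refine DifferentiableAt.differentiableWithinAt (DifferentiableAt.comp s (g := riemannZeta)
      (f := fun z => z + 1) (differentiableAt_riemannZeta ?_) (differentiableAt_id.add_const 1))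
    intro h
    have h0 : s = 0 := by simpa using h
    have := ball_one_subset hs
    simp [h0] at this

theorem hasExpSum_one_div_Gamma {w : ℂ} (hw : ‖w‖ < 1) :
    HasExpSum w (fun m => (-1) ^ m * gCoeff m) (1 / Complex.Gamma (1 - w)) := by
  refine HasExpSum.taylor (w := w) (F := fun s => 1 / Complex.Gamma s) (fun s hs => ?_) hw
  have h0 := ball_one_subset hs
  exact ((differentiableAt_const _).div
    (Complex.differentiableAt_Gamma s (ne_neg_natCast_of_re_pos h0))
    (Complex.Gamma_ne_zero_of_re_pos h0)).differentiableWithinAt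

/-- The closed form of `γ_{A(k)}(m)`. -/
def gammaAFormula (k m : ℕ) : ℂ :=
  (-1) ^ m * iteratedDeriv m riemannZeta 2
    - 1 / (k : ℂ) * ∑ v ∈ range (m + 1),
        (m.choose v : ℂ) * (psiOne (v + 1) / ((v : ℂ) + 1)) * (-1) ^ v *
          (Real.log k : ℂ) ^ (m - v)
    + (-1) ^ m * ∑ v ∈ range (m + 1),
        (m.choose v : ℂ) * gCoeff (m - v) * (iIntegral v k : ℂ)
    + (psiOne 0 - ((m : ℂ) + 1) / ((m : ℂ) + 2) * (Real.log k : ℂ)) *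
        ((Real.log k : ℂ) ^ (m + 1) / ((k : ℂ) * ((m : ℂ) + 1)))
    + 1 / (k : ℂ) * ∑ v ∈ range (m + 1),
        (m.choose v : ℂ) *
          (stieltjesConst v * (Real.log k : ℂ) + stieltjesConst (v + 1)) *
          (Real.log k : ℂ) ^ (m - v)
    - 1 / (k : ℂ) * ∑ j ∈ range (m + 1),
        (m.choose j : ℂ) * (-1) ^ j * (Real.log k : ℂ) ^ (m - j) *
          ∑ v ∈ range (j + 1),
            (j.choose v : ℂ) * (-1) ^ v * psiOne (j - v) * stieltjesConst v

theorem neg_one_pow_mul_neg_one_pow_sub {m v : ℕ} (hv : v ≤ m) :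
    (-1 : ℂ) ^ v * (-1) ^ (m - v) = (-1) ^ m := by
  rw [← pow_add, Nat.add_sub_cancel' hv]

theorem neg_one_pow_sub {m v : ℕ} (hv : v ≤ m) : (-1 : ℂ) ^ (m - v) = (-1) ^ m * (-1) ^ v := by
  have h : (-1 : ℂ) ^ v * (-1) ^ v = 1 := by
    rw [← mul_pow]
    norm_num
  rw [← neg_one_pow_mul_neg_one_pow_sub hv]
  linear_combination -(-1 : ℂ) ^ (m - v) * h

theorem hasExpSum_zetaAFormula {k : ℕ} (hk : 1 ≤ k) {w : ℂ} (hw : w ≠ 0) (hw1 : ‖w‖ < 1) :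
    HasExpSum w (gammaAFormula k) (zetaAFormula k (1 - w) - 1 / (k : ℂ) / w ^ 2 +
        (Real.eulerMascheroniConstant : ℂ) / (k : ℂ) / w) := by
  rw [zetaAFormula_sub_polar hk hw]
  set L : ℂ := (Real.log k : ℂ) with hL
  have hψ := hasExpSum_digamma hw1
  have hZ := hasExpSum_zetaRegular hw1
  have hψ1 := hψ.shift hw
  have hE := HasExpSum.exp L w
  have hE1 := hE.shift hw
  have hE2 := hE1.shift hw
  simp only [pow_zero, one_mul, zero_add, pow_one, Nat.cast_zero, div_one] at hψ1 hE1 hE2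
  -- The first factor of each product receives the index `v` and the second `m - v`. The order is
  -- chosen to match `gammaAFormula`; the values are commuted back afterwards.
  have h := ((hasExpSum_riemannZeta_add_one hw1).add ((hasExpSum_mellin_iIntegrand hk hw1).mul
    (hasExpSum_one_div_Gamma hw1))).add (HasExpSum.const_mul (1 / (k : ℂ))
    ((((((hψ1.add (hZ.const_mul L)).sub (hasExpSum_deriv_zetaRegular hw1)).sub
      (hZ.mul hψ)).mul hE).add (hE1.const_mul (psiOne 0 - L))).add hE2))
  rw [mul_comm (mellin _ _), mul_comm L, mul_comm (zetaRegular (1 - w)) (Complex.digamma _)] at h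
  convert! h using 1
  funext m
  have hm1 : (m : ℂ) + 1 ≠ 0 := Nat.cast_add_one_ne_zero m
  have hm2 : (m : ℂ) + 2 ≠ 0 := by exact_mod_cast (by omega : m + 2 ≠ 0)
  have hk0 : (k : ℂ) ≠ 0 := by exact_mod_cast (by omega : k ≠ 0)
  have hI : ∑ v ∈ range (m + 1), (m.choose v : ℂ) * ((-1) ^ v * (iIntegral v k : ℂ)) *
        ((-1) ^ (m - v) * gCoeff (m - v)) =
      (-1) ^ m * ∑ v ∈ range (m + 1),
        (m.choose v : ℂ) * gCoeff (m - v) * (iIntegral v k : ℂ) := by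
    rw [mul_sum]
    refine sum_congr rfl fun v hv => ?_
    rw [← neg_one_pow_mul_neg_one_pow_sub (Nat.lt_succ_iff.mp (mem_range.mp hv))]
    ring
  have hJ : ∀ j, ∑ v ∈ range (j + 1), (j.choose v : ℂ) * stieltjesConst v *
        ((-1) ^ (j - v) * psiOne (j - v)) =
      (-1) ^ j * ∑ v ∈ range (j + 1),
        (j.choose v : ℂ) * (-1) ^ v * psiOne (j - v) * stieltjesConst v := by
    intro j
    rw [mul_sum]
    refine sum_congr rfl fun v hv => ?_
    rw [neg_one_pow_sub (Nat.lt_succ_iff.mp (mem_range.mp hv))]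
    ring
  have hS : ∑ v ∈ range (m + 1), (m.choose v : ℂ) *
        ((-1) ^ (v + 1) * psiOne (v + 1) / ((v : ℂ) + 1) + L * stieltjesConst v -
          -1 * stieltjesConst (v + 1) - (-1) ^ v * ∑ i ∈ range (v + 1),
            (v.choose i : ℂ) * (-1) ^ i * psiOne (v - i) * stieltjesConst i) * L ^ (m - v) =
      - ∑ v ∈ range (m + 1),
        (m.choose v : ℂ) * (psiOne (v + 1) / ((v : ℂ) + 1)) * (-1) ^ v * L ^ (m - v)
      + ∑ v ∈ range (m + 1),
        (m.choose v : ℂ) * (stieltjesConst v * L + stieltjesConst (v + 1)) * L ^ (m - v)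
      - ∑ j ∈ range (m + 1), (m.choose j : ℂ) * (-1) ^ j * L ^ (m - j) *
          ∑ v ∈ range (j + 1),
            (j.choose v : ℂ) * (-1) ^ v * psiOne (j - v) * stieltjesConst v := by
    rw [← sum_neg_distrib, ← sum_add_distrib, ← sum_sub_distrib]
    refine sum_congr rfl fun v _ => ?_
    rw [pow_succ]
    ring
  simp only [hJ]
  rw [hI, hS, gammaAFormula, ← hL]
  -- The tails left by the simple and double poles combine through `-1 + 1 / (m + 2) = -(m + 1) / (m
  -- + 2)`.
  have hpoly : (psiOne 0 - ((m : ℂ) + 1) / ((m : ℂ) + 2) * L) *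
        (L ^ (m + 1) / ((k : ℂ) * ((m : ℂ) + 1))) =
      1 / (k : ℂ) * ((psiOne 0 - L) * (L ^ (m + 1) / ((m : ℂ) + 1)) +
        L ^ (m + 1 + 1) / (((m + 1 : ℕ) : ℂ) + 1) / ((m : ℂ) + 1)) := by
    have hm3 : ((m + 1 : ℕ) : ℂ) + 1 = (m : ℂ) + 2 := by
      push_cast
      ring
    rw [hm3, pow_succ L (m + 1)]
    field_simp
    ring
  rw [hpoly]
  ring

theorem hasStieltjesExpansion_zetaA {k : ℕ} (hk : 1 ≤ k) :
    HasStieltjesExpansion (zetaA k) (1 / (k : ℂ))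
      ((Real.eulerMascheroniConstant : ℂ) / (k : ℂ)) (gammaAFormula k) := by
  refine hasStieltjesExpansion_of_hasExpSum fun w hw hw1 => ?_
  rw [zetaA_eq_zetaAFormula hk (ball_one_subset (by simpa [dist_eq_norm] using hw1))
    (by simpa using hw)]
  exact hasExpSum_zetaAFormula hk hw hw1

end

/-- Closed form of the constants `γ_{A(k)}(m)`, with the existence of the objects involved. -/
theorem mainTheorem5 (k : ℕ) (hk : 1 ≤ k) :
    IsZetaAContinuation k (zetaA k) ∧
    HasStieltjesExpansion (zetaA k) (1 / (k : ℂ))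
      ((Real.eulerMascheroniConstant : ℂ) / (k : ℂ)) (gammaA k) ∧
    (∀ v : ℕ, MeasureTheory.IntegrableOn (iIntegrand v k) (Set.Ioi (0 : ℝ))) ∧
    ∀ m : ℕ,
      gammaA k m =
        (-1) ^ m * iteratedDeriv m riemannZeta 2
        - 1 / (k : ℂ) * ∑ v ∈ Finset.range (m + 1),
            (m.choose v : ℂ) * (psiOne (v + 1) / ((v : ℂ) + 1)) * (-1) ^ v *
              (Real.log k : ℂ) ^ (m - v)
        + (-1) ^ m * ∑ v ∈ Finset.range (m + 1),
            (m.choose v : ℂ) * gCoeff (m - v) * (iIntegral v k : ℂ)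
        + (psiOne 0 - ((m : ℂ) + 1) / ((m : ℂ) + 2) * (Real.log k : ℂ)) *
            ((Real.log k : ℂ) ^ (m + 1) / ((k : ℂ) * ((m : ℂ) + 1)))
        + 1 / (k : ℂ) * ∑ v ∈ Finset.range (m + 1),
            (m.choose v : ℂ) *
              (stieltjesConst v * (Real.log k : ℂ) + stieltjesConst (v + 1)) *
              (Real.log k : ℂ) ^ (m - v)
        - 1 / (k : ℂ) * ∑ j ∈ Finset.range (m + 1),
            (m.choose j : ℂ) * (-1) ^ j * (Real.log k : ℂ) ^ (m - j) *
              ∑ v ∈ Finset.range (j + 1),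
                (j.choose v : ℂ) * (-1) ^ v * psiOne (j - v) * stieltjesConst v := by
  have h := hasStieltjesExpansion_zetaA hk
  have hA : HasStieltjesExpansion (zetaA k) (1 / (k : ℂ))
      ((Real.eulerMascheroniConstant : ℂ) / (k : ℂ)) (gammaA k) :=
    Classical.epsilon_spec (p := HasStieltjesExpansion (zetaA k) (1 / (k : ℂ))
      ((Real.eulerMascheroniConstant : ℂ) / (k : ℂ))) ⟨_, h⟩
  exact ⟨isZetaAContinuation_zetaA hk, hA, integrableOn_iIntegrand hk,
    fun m => congrFun (hA.unique h) m⟩
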